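/- Let $G$ be a finite group and let $\mathcal Q\colon G\to \mathrm{GL}_n(\mathbb C)$ be a projective representation of $G$ with factor set $\alpha\colon G\times G\to\mathbb C^\times$, that is, $\mathcal Q(g)\mathcal Q(h)=\alpha(g,h)\,\mathcal Q(gh)$ for all $g,h\in G$. Suppose that every value of $\alpha$ is a root of unity and that $\alpha(1,1)=1$. Then there is a projective representation $\mathcal Q'\colon G\to\mathrm{GL}_n(\mathbb C)$ similar to $\mathcal Q$ (that is, there is $M\in\mathrm{GL}_n(\mathbb C)$ with $\mathcal Q'(g)=M^{-1}\mathcal Q(g)M$ for all $g\in G$) such that all entries of all matrices $\mathcal Q'(g)$, $g\in G$, lie in a single finite cyclotomic extension of $\mathbb Q$ inside $\mathbb C$, that is, in $\mathbb Q(\xi_m)$ for some integer $m\ge 1$, where $\xi_m\in\mathbb C$ is a primitive $m$-th root of unity. -/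

import Mathlib

/-- A projective representation of degree `n` of the group `G` over the field `F`: a map
`G → GL(n, F)` that is multiplicative up to scalars. -/
structure ProjectiveRepresentation (F : Type*) [Field F] (G : Type*) [Group G] (n : ℕ) where
  /-- The underlying map to invertible matrices. -/
  toFun : G → Matrix.GeneralLinearGroup (Fin n) F
  exists_scalar : ∀ g h : G, ∃ a : Fˣ,
    (toFun g : Matrix (Fin n) (Fin n) F) * (toFun h : Matrix (Fin n) (Fin n) F) =
      (a : F) • (toFun (g * h) : Matrix (Fin n) (Fin n) F)

namespace ProjectiveRepresentation

/-- `α` is the factor set of `P`, that is, `P g * P h = α (g, h) P (g * h)` for all `g, h`.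
(For `n ≠ 0` it is uniquely determined by `P`.) -/
def IsFactorSet {F : Type*} [Field F] {G : Type*} [Group G] {n : ℕ}
    (P : ProjectiveRepresentation F G n) (α : G → G → Fˣ) : Prop :=
  ∀ g h : G,
    (P.toFun g : Matrix (Fin n) (Fin n) F) * (P.toFun h : Matrix (Fin n) (Fin n) F) =
      (α g h : F) • (P.toFun (g * h) : Matrix (Fin n) (Fin n) F)

/-- Two projective representations are similar if they are conjugate by a single invertible
matrix over `F`. No rescaling of the individual matrices is allowed. -/
def Similar {F : Type*} [Field F] {G : Type*} [Group G] {n : ℕ}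
    (P P' : ProjectiveRepresentation F G n) : Prop :=
  ∃ M : Matrix.GeneralLinearGroup (Fin n) F, ∀ g : G, P'.toFun g = M⁻¹ * P.toFun g * M

end ProjectiveRepresentation

/-!
The matrices `z • Q g`, with `z` a root of unity of order dividing a common exponent of the values
of the factor set, form a finite subgroup `Γ` of `GL_n(ℂ)`. So the claim follows from a weak form of
Brauer's theorem on splitting fields: a complex representation of a finite group `G` can be
realized over every field `K` of characteristic zero inside `ℂ` that contains the roots of unity
of order `|G|`. This is applied to `Γ` and the cyclotomic field of order `|Γ|`.

Brauer's theorem is proved by induction from hyperelementary subgroups, that is, from extensions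
of a `p`-group by a cyclic group.

* Representations of hyperelementary groups are built by induction from representations by scalars,
  so their characters are characters over `K` (`IsHyperelementary.isCharacter`).
* The integer-valued functions on `G` that multiply complex characters into virtual characters
  over `K` form a ring without unit (`mul_mem_multiplierSubgroup`). If `H` is hyperelementary, the
  permutation character of `G ⧸ H` lies in it: its product with `χ` is the character induced from
  the restriction of `χ` to `H` (`inducedFunction_restrict`). For every `g` and every prime `p`,
  one of these permutation characters is prime to `p` at `g` (`exists_isHyperelementary_not_dvd`),
  and this forces the ring to contain `1` (`one_mem_of_forall_exists_not_dvd`). So every complex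
  character is a difference of two characters over `K`.
* If a complex character is a difference of two characters over `K`, it is itself a character
  over `K`, since common constituents can be cancelled and disjoint representations over `K`
  remain disjoint over `ℂ` (`IsCharacter.of_eq_sub`). Representations with equal characters are
  isomorphic (`nonempty_equiv_of_char_eq`), which gives the conjugating matrix.
-/

open Module

/-! ### Characters and virtual characters over a subfield -/

section Characters

variable {G : Type*} [Group G] (K : Type*) [Field K] [Algebra K ℂ]

/-- `IsCharacter K χ` says that the complex-valued function `χ` on `G` is the character of a
matrix representation of `G` with entries in `K`, where `K` is mapped to `ℂ` by its algebra
structure. The degree may be zero, so the zero function is a character. -/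
def IsCharacter (χ : G → ℂ) : Prop :=
  ∃ (n : ℕ) (ρ : G →* Matrix (Fin n) (Fin n) K), ∀ g, χ g = algebraMap K ℂ (ρ g).trace

/-- The group of virtual characters of `G` over `K`: the additive group generated by the
characters of the representations of `G` over `K`, inside the complex functions on `G`. -/
def virtualCharacters (G : Type*) [Group G] (K : Type*) [Field K] [Algebra K ℂ] :
    AddSubgroup (G → ℂ) :=
  AddSubgroup.closure {χ | IsCharacter K χ}

variable {K}

theorem IsCharacter.mem_virtualCharacters {χ : G → ℂ} (h : IsCharacter K χ) :
    χ ∈ virtualCharacters G K :=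
  AddSubgroup.subset_closure h

theorem IsCharacter.of_matrix {ι : Type*} [Fintype ι] [DecidableEq ι] (ρ : G →* Matrix ι ι K)
    {χ : G → ℂ} (h : ∀ g, χ g = algebraMap K ℂ (ρ g).trace) : IsCharacter K χ := by
  let e := Fintype.equivFin ι
  refine ⟨Fintype.card ι, (Matrix.reindexAlgEquiv K K e : _ →* _).comp ρ, fun g => ?_⟩
  rw [h]
  congr 1
  simp only [MonoidHom.coe_comp, Function.comp_apply, Matrix.trace, Matrix.diag]
  exact (Equiv.sum_comp e.symm (fun i => ρ g i i)).symm

theorem IsCharacter.of_representation {V : Type*} [AddCommGroup V] [Module K V]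
    [FiniteDimensional K V] (ρ : Representation K G V) {χ : G → ℂ}
    (h : ∀ g, χ g = algebraMap K ℂ (ρ.character g)) : IsCharacter K χ := by
  let b := finBasis K V
  refine ⟨_, (LinearMap.toMatrixAlgEquiv b).toMulEquiv.toMonoidHom.comp ρ, fun g => ?_⟩
  rw [h, Representation.character, LinearMap.trace_eq_matrix_trace K b]
  rfl

theorem IsCharacter.exists_representation {χ : G → ℂ} (h : IsCharacter K χ) :
    ∃ (n : ℕ) (ρ : Representation K G (Fin n → K)), ∀ g, χ g = algebraMap K ℂ (ρ.character g) := by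
  obtain ⟨n, ρ, hρ⟩ := h
  refine ⟨n, (Matrix.toLinAlgEquiv' : _ ≃ₐ[K] _).toMonoidHom.comp ρ, fun g => ?_⟩
  rw [hρ, Representation.character]
  congr 1
  exact (Matrix.trace_toLin'_eq (ρ g)).symm

theorem IsCharacter.add {χ ψ : G → ℂ} (hχ : IsCharacter K χ) (hψ : IsCharacter K ψ) :
    IsCharacter K (χ + ψ) := by
  obtain ⟨n, ρ, hρ⟩ := hχ.exists_representation
  obtain ⟨m, σ, hσ⟩ := hψ.exists_representation
  refine .of_representation (ρ.prod σ) fun g => ?_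
  rw [Pi.add_apply, hρ, hσ, ← map_add]
  congr 1
  exact (LinearMap.trace_prodMap' (ρ g) (σ g)).symm

theorem IsCharacter.comp {H : Type*} [Group H] {χ : G → ℂ} (hχ : IsCharacter K χ) (f : H →* G) :
    IsCharacter K (χ ∘ f) := by
  obtain ⟨n, ρ, hρ⟩ := hχ
  exact ⟨n, ρ.comp f, fun g => hρ (f g)⟩

theorem IsCharacter.complex {χ : G → ℂ} (hχ : IsCharacter K χ) : IsCharacter ℂ χ := by
  obtain ⟨n, ρ, hρ⟩ := hχ
  refine ⟨n, (algebraMap K ℂ).mapMatrix.toMonoidHom.comp ρ, fun g => ?_⟩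
  rw [hρ]
  exact AddMonoidHom.map_trace (algebraMap K ℂ).toAddMonoidHom (ρ g)

theorem IsCharacter.conj_apply {χ : G → ℂ} (hχ : IsCharacter K χ) (g h : G) :
    χ (h⁻¹ * g * h) = χ g := by
  obtain ⟨n, ρ, hρ⟩ := hχ
  rw [hρ, hρ, map_mul, Matrix.trace_mul_comm, ← map_mul, mul_inv_cancel_left]

theorem exists_eq_sub_of_mem_virtualCharacters {χ : G → ℂ} (hχ : χ ∈ virtualCharacters G K) :
    ∃ χ₁ χ₂ : G → ℂ, IsCharacter K χ₁ ∧ IsCharacter K χ₂ ∧ χ = χ₁ - χ₂ := by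
  have h0 : IsCharacter K (0 : G → ℂ) :=
    ⟨0, 1, fun g => by simp [Matrix.trace]⟩
  induction hχ using AddSubgroup.closure_induction with
  | mem x hx => exact ⟨x, 0, hx, h0, by simp⟩
  | zero => exact ⟨0, 0, h0, h0, by simp⟩
  | add x y _ _ hx hy =>
    obtain ⟨a, b, ha, hb, rfl⟩ := hx
    obtain ⟨c, d, hc, hd, rfl⟩ := hy
    exact ⟨a + c, b + d, ha.add hc, hb.add hd, by abel⟩
  | neg x _ hx =>
    obtain ⟨a, b, ha, hb, rfl⟩ := hx
    exact ⟨b, a, hb, ha, by abel⟩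

end Characters

/-! ### Equality and cancellation of characters -/

section Maschke

variable {G : Type*} [Group G] [Finite G] {K : Type*} [Field K] [CharZero K]

namespace Representation

variable {V W : Type*} [AddCommGroup V] [Module K V] [AddCommGroup W] [Module K W]
  {ρ : Representation K G V} {σ : Representation K G W}

theorem exists_isCompl_subrepresentation (A : Subrepresentation ρ) :
    ∃ B : Subrepresentation ρ, IsCompl A B := by
  have : NeZero (Nat.card G : K) := ⟨Nat.cast_ne_zero.2 Nat.card_pos.ne'⟩
  have : IsSemisimpleRepresentation ρ :=
    isSemisimpleRepresentation_iff_isSemisimpleModule_asModule ρ |>.2 inferInstance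
  exact exists_isCompl A

omit [Finite G] [CharZero K] in
theorem isCompl_toSubmodule {A B : Subrepresentation ρ} (h : IsCompl A B) :
    IsCompl A.toSubmodule B.toSubmodule := by
  constructor
  · rw [disjoint_iff, ← Subrepresentation.toSubmodule_inf, h.inf_eq_bot]; rfl
  · rw [codisjoint_iff, ← Subrepresentation.toSubmodule_sup, h.sup_eq_top]; rfl

/-- A representation is the direct product of two complementary subrepresentations. -/
noncomputable def prodEquivOfIsCompl {A B : Subrepresentation ρ} (h : IsCompl A B) :
    (A.toRepresentation.prod B.toRepresentation).Equiv ρ :=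
  .mk (Submodule.prodEquivOfIsCompl _ _ (isCompl_toSubmodule h)) fun g => by
    ext x <;> simp [Subrepresentation.toRepresentation]

/-- The first isomorphism theorem, with a complement of the kernel in place of the quotient. -/
noncomputable def complKerEquivRange (f : IntertwiningMap ρ σ) {B : Subrepresentation ρ}
    (h : IsCompl f.ker B) : B.toRepresentation.Equiv f.range.toRepresentation :=
  .mk (LinearMap.kerComplementEquivRange f.toLinearMap (isCompl_toSubmodule h).symm) fun g => by
    ext x
    exact f.isIntertwining _ _ g x

end Representation

open Representation

/-- The inner product of two characters, multiplied by the order of the group, as an integer. -/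
theorem sum_mul_char_eq_finrank [Fintype G] {V W : Type*} [AddCommGroup V] [Module K V]
    [FiniteDimensional K V] [AddCommGroup W] [Module K W] [FiniteDimensional K W]
    (ρ : Representation K G V) (σ : Representation K G W) :
    ∑ g : G, σ.character g * ρ.character g⁻¹ =
      (Nat.card G * finrank K (IntertwiningMap ρ σ) : ℕ) := by
  have h0 : (Nat.card G : K) ≠ 0 := Nat.cast_ne_zero.2 Nat.card_pos.ne'
  have : Invertible (Nat.card G : K) := invertibleOfNonzero h0
  rw [Nat.cast_mul, ← card_inv_mul_sum_char_mul_char_eq_finrank, mul_inv_cancel_left₀ h0]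

/-- If the space of intertwining maps is not zero, the two representations have a common
constituent `B ≅ R` and splittings `ρ ≅ A × B` and `σ ≅ S × R`. -/
theorem exists_common_constituent {V W : Type*} [AddCommGroup V] [Module K V]
    [FiniteDimensional K V] [AddCommGroup W] [Module K W] [FiniteDimensional K W]
    {ρ : Representation K G V} {σ : Representation K G W} (f : IntertwiningMap ρ σ) (hf : f ≠ 0) :
    ∃ (A B : Subrepresentation ρ) (S R : Subrepresentation σ), IsCompl A B ∧ IsCompl S R ∧
      Nonempty (B.toRepresentation.Equiv R.toRepresentation) ∧
      finrank K A.toSubmodule < finrank K V := by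
  obtain ⟨B, hB⟩ := exists_isCompl_subrepresentation f.ker
  obtain ⟨S, hS⟩ := exists_isCompl_subrepresentation f.range
  refine ⟨f.ker, B, S, f.range, hB, hS.symm, ⟨complKerEquivRange f hB⟩, ?_⟩
  refine Submodule.finrank_lt fun h => hf ?_
  ext v
  have : v ∈ f.ker.toSubmodule := h ▸ Submodule.mem_top
  exact this

omit [Finite G] [CharZero K] in
theorem char_eq_add_of_isCompl {V : Type*} [AddCommGroup V] [Module K V]
    [FiniteDimensional K V] {ρ : Representation K G V} {A B : Subrepresentation ρ}
    (h : IsCompl A B) (g : G) :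
    ρ.character g = A.toRepresentation.character g + B.toRepresentation.character g := by
  rw [← char_iso (prodEquivOfIsCompl h)]
  exact LinearMap.trace_prodMap' _ _

/-- The product of two isomorphisms of representations. -/
noncomputable def Representation.Equiv.prodCongr {k G V V' W W' : Type*} [Field k] [Group G]
    [AddCommGroup V] [Module k V] [AddCommGroup W] [Module k W]
    [AddCommGroup V'] [Module k V'] [AddCommGroup W'] [Module k W']
    {ρ : Representation k G V} {σ : Representation k G W}
    {ρ' : Representation k G V'} {σ' : Representation k G W'}
    (e : ρ.Equiv ρ') (f : σ.Equiv σ') : (ρ.prod σ).Equiv (ρ'.prod σ') :=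
  .mk (e.toLinearEquiv.prodCongr f.toLinearEquiv) fun g => by
    ext x
    · exact e.isIntertwining _ _ g x
    · simp
    · simp
    · exact f.isIntertwining _ _ g x

/-- Over a field of characteristic zero, representations of a finite group with the same
character are isomorphic: a common constituent can be split off from both. -/
theorem nonempty_equiv_of_char_eq {V W : Type*} [AddCommGroup V] [Module K V]
    [FiniteDimensional K V] [AddCommGroup W] [Module K W] [FiniteDimensional K W]
    (ρ : Representation K G V) (σ : Representation K G W) (h : ρ.character = σ.character) :
    Nonempty (ρ.Equiv σ) := by
  have := Fintype.ofFinite G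
  induction hn : finrank K V using Nat.strong_induction_on generalizing V W with
  | _ n ih =>
    have hdim : finrank K V = finrank K W := by
      have := congrFun h 1
      rw [char_one, char_one] at this
      exact_mod_cast this
    rcases subsingleton_or_nontrivial V with hV | hV
    · have hW : Subsingleton W := by
        rw [← finrank_zero_iff (R := K), ← hdim, finrank_zero_iff]; exact hV
      exact ⟨.mk 0 fun g => Subsingleton.elim _ _⟩
    -- The inner product of the common character with itself is positive.
    obtain ⟨f, hf⟩ : ∃ f : IntertwiningMap ρ σ, f ≠ 0 := by
      by_contra! h0
      have h1 : finrank K (IntertwiningMap ρ σ) = 0 :=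
        have : Subsingleton (IntertwiningMap ρ σ) := ⟨fun a b => (h0 a).trans (h0 b).symm⟩
        finrank_zero_of_subsingleton
      have h2 := sum_mul_char_eq_finrank ρ σ
      rw [← h, sum_mul_char_eq_finrank ρ ρ, h1, mul_zero, Nat.cast_inj, mul_eq_zero] at h2
      have h3 := h2.resolve_left Nat.card_pos.ne'
      have : FiniteDimensional K (IntertwiningMap ρ ρ) :=
        .equiv (invariantsEquivIntertwiningMap ρ ρ)
      rw [finrank_zero_iff] at h3
      obtain ⟨v, hv⟩ := exists_ne (0 : V)
      exact hv (congrArg (fun f : IntertwiningMap ρ ρ => f v)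
        (Subsingleton.elim (IntertwiningMap.id ρ) 0))
    obtain ⟨A, B, S, R, hAB, hSR, ⟨e⟩, hlt⟩ := exists_common_constituent f hf
    obtain ⟨e'⟩ := ih _ (hn ▸ hlt) A.toRepresentation S.toRepresentation (by
      ext g
      have := congrFun h g
      rw [char_eq_add_of_isCompl hAB, char_eq_add_of_isCompl hSR, char_iso e] at this
      exact add_right_cancel this) rfl
    exact ⟨(prodEquivOfIsCompl hAB).symm.trans ((e'.prodCongr e).trans (prodEquivOfIsCompl hSR))⟩

/-- If a complex character is a difference of characters of representations over `K`, it is itself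
the character of a representation over `K`. Common constituents of the two representations over
`K` can be cancelled; if there are none, the subtracted representation is disjoint from the other
one also over `ℂ`, so it has to be zero. -/
theorem IsCharacter.of_eq_sub [Algebra K ℂ] {χ χ₁ χ₂ : G → ℂ} (hχ : IsCharacter ℂ χ)
    (h₁ : IsCharacter K χ₁) (h₂ : IsCharacter K χ₂) (h : χ = χ₁ - χ₂) : IsCharacter K χ := by
  have := Fintype.ofFinite G
  obtain ⟨n₁, ρ, hρ⟩ := h₁.exists_representation
  obtain ⟨n₂, σ, hσ⟩ := h₂.exists_representation
  clear h₁ h₂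
  -- Induction on the degree of the subtracted representation.
  suffices H : ∀ (n : ℕ) (V W : Type _) [AddCommGroup V] [Module K V] [FiniteDimensional K V]
      [AddCommGroup W] [Module K W] [FiniteDimensional K W] (ρ : Representation K G V)
      (σ : Representation K G W), finrank K W = n →
      (∀ g, χ g = algebraMap K ℂ (ρ.character g) - algebraMap K ℂ (σ.character g)) →
      IsCharacter K χ from
    H _ _ _ ρ σ rfl fun g => by rw [h, Pi.sub_apply, hρ, hσ]
  clear! n₁ n₂ χ₁ χ₂
  intro n
  induction n using Nat.strong_induction_on with
  | _ n ih =>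
    intro V W _ _ _ _ _ _ ρ σ hn h
    by_cases hf : ∃ f : IntertwiningMap σ ρ, f ≠ 0
    · obtain ⟨f, hf⟩ := hf
      obtain ⟨A, B, S, R, hAB, hSR, ⟨e⟩, hlt⟩ := exists_common_constituent f hf
      refine ih _ (hn ▸ hlt) _ _ S.toRepresentation A.toRepresentation rfl fun g => ?_
      rw [h, char_eq_add_of_isCompl hAB, char_eq_add_of_isCompl hSR, char_iso e, map_add, map_add]
      ring
    · push Not at hf
      have h0 : finrank K (IntertwiningMap σ ρ) = 0 :=
        have : Subsingleton (IntertwiningMap σ ρ) := ⟨fun a b => (hf a).trans (hf b).symm⟩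
        finrank_zero_of_subsingleton
      have hσ : IsCharacter K (fun g => algebraMap K ℂ (σ.character g)) :=
        .of_representation σ fun _ => rfl
      obtain ⟨a, χ', hχ'⟩ := hχ.exists_representation
      obtain ⟨b, σ', hσ'⟩ := hσ.complex.exists_representation
      -- Write `χ₁`, `χ₂` for the characters of `ρ` and `σ`. As `⟨χ₁, χ₂⟩ = 0`, the nonnegative
      -- numbers `⟨χ, χ₂⟩` and `⟨χ₂, χ₂⟩` have sum zero.
      have h1 := sum_mul_char_eq_finrank σ' χ'
      have h2 := congrArg (algebraMap K ℂ) (sum_mul_char_eq_finrank σ ρ)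
      have h3 := congrArg (algebraMap K ℂ) (sum_mul_char_eq_finrank σ σ)
      simp only [Algebra.algebraMap_self, RingHom.id_apply] at hχ' hσ'
      simp only [← hχ', ← hσ', h, sub_mul, Finset.sum_sub_distrib] at h1
      simp only [map_sum, map_mul, h0, mul_zero, Nat.cast_zero, map_zero, map_natCast] at h2 h3
      rw [h2, h3, zero_sub, neg_eq_iff_add_eq_zero, ← Nat.cast_add, Nat.cast_eq_zero] at h1
      have h4 : finrank K (IntertwiningMap σ σ) = 0 := by
        have := (Nat.add_eq_zero_iff.1 h1).1
        exact (mul_eq_zero.1 this).resolve_left Nat.card_pos.ne'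
      have : FiniteDimensional K (IntertwiningMap σ σ) :=
        .equiv (invariantsEquivIntertwiningMap σ σ)
      rw [finrank_zero_iff] at h4
      have hW : Subsingleton W := subsingleton_of_forall_eq 0 fun v =>
        congrArg (fun f : IntertwiningMap σ σ => f v) (Subsingleton.elim (IntertwiningMap.id σ) 0)
      refine .of_representation ρ fun g => ?_
      rw [h, Representation.character, Representation.character, Subsingleton.elim (σ g) 0, map_zero,
        map_zero, sub_zero]

end Maschke

/-! ### Induced characters -/

section Induction

variable {G : Type*} [Group G] [Finite G] {K : Type*} [Field K] [Algebra K ℂ]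

open scoped Classical in
/-- Extension of a function on a subgroup to the whole group by zero. -/
noncomputable def Subgroup.extendZero {R : Type*} [Zero R] (H : Subgroup G) (φ : H → R) (g : G) :
    R :=
  if h : g ∈ H then φ ⟨g, h⟩ else 0

omit [Finite G] in
theorem Subgroup.extendZero_of_mem {R : Type*} [Zero R] {H : Subgroup G} (φ : H → R) {g : G}
    (h : g ∈ H) : H.extendZero φ g = φ ⟨g, h⟩ := dif_pos h

omit [Finite G] in
theorem Subgroup.extendZero_of_notMem {R : Type*} [Zero R] {H : Subgroup G} (φ : H → R) {g : G}
    (h : g ∉ H) : H.extendZero φ g = 0 := dif_neg h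

/-- The induced class function: the sum over the cosets `a` of `H`, with representative `s`, of
the value of `φ` at `s⁻¹ * g * s`, read as zero if this element is outside `H`. For class
functions `φ` the choice of representatives does not matter. For infinitely many cosets the finite
sum may take the junk value zero; only finite groups are considered. -/
noncomputable def inducedFunction (H : Subgroup G) (φ : H → ℂ) (g : G) : ℂ :=
  ∑ᶠ a : G ⧸ H, H.extendZero φ (a.out⁻¹ * g * a.out)

omit [Finite G] in
theorem out_inv_mul_mul_out_mem_iff (H : Subgroup G) (g : G) (a b : G ⧸ H) :
    a.out⁻¹ * g * b.out ∈ H ↔ g • b = a := by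
  rw [mul_assoc, ← QuotientGroup.eq, QuotientGroup.out_eq', eq_comm]
  conv_rhs => rw [← QuotientGroup.out_eq' b]
  rfl

theorem IsCharacter.inducedFunction {H : Subgroup G} {φ : H → ℂ} (hφ : IsCharacter K φ) :
    IsCharacter K (inducedFunction H φ) := by
  classical
  have := Fintype.ofFinite (G ⧸ H)
  obtain ⟨n, ρ, hρ⟩ := hφ
  -- The block at `(a, b)` is `ρ` at `a.out⁻¹ * g * b.out`; each row has one nonzero block.
  let M : G → Matrix ((G ⧸ H) × Fin n) ((G ⧸ H) × Fin n) K := fun g =>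
    Matrix.of fun x y => H.extendZero ρ (x.1.out⁻¹ * g * y.1.out) x.2 y.2
  have h1 : M 1 = 1 := by
    ext ⟨a, i⟩ ⟨b, j⟩
    by_cases hab : b = a
    · subst hab
      have hm : b.out⁻¹ * 1 * b.out ∈ H := by simp
      have h' : (⟨b.out⁻¹ * 1 * b.out, hm⟩ : H) = 1 := Subtype.ext (by simp)
      simp only [M, Matrix.of_apply, Subgroup.extendZero_of_mem _ hm, h', map_one,
        Matrix.one_apply, Prod.mk.injEq, true_and]
    · have hm : a.out⁻¹ * 1 * b.out ∉ H := by
        rwa [out_inv_mul_mul_out_mem_iff, one_smul]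
      rw [Matrix.one_apply_ne fun h => hab (congrArg Prod.fst h).symm]
      simp only [M, Matrix.of_apply, Subgroup.extendZero_of_notMem _ hm, Matrix.zero_apply]
  have hmul : ∀ g g', M (g * g') = M g * M g' := by
    intro g g'
    ext ⟨a, i⟩ ⟨c, j⟩
    rw [Matrix.mul_apply, Fintype.sum_prod_type, Finset.sum_eq_single (g' • c)]
    · have h2 : (g' • c).out⁻¹ * g' * c.out ∈ H := (out_inv_mul_mul_out_mem_iff _ _ _ _).2 rfl
      simp only [M, Matrix.of_apply, Subgroup.extendZero_of_mem _ h2]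
      by_cases ha : g • g' • c = a
      · have h1 : a.out⁻¹ * g * (g' • c).out ∈ H := (out_inv_mul_mul_out_mem_iff _ _ _ _).2 ha
        have h3 : a.out⁻¹ * (g * g') * c.out ∈ H :=
          (out_inv_mul_mul_out_mem_iff _ _ _ _).2 (by rwa [mul_smul])
        rw [Subgroup.extendZero_of_mem _ h1, Subgroup.extendZero_of_mem _ h3, ← Matrix.mul_apply,
          ← map_mul]
        exact congrArg (fun h => ρ h i j) (Subtype.ext (by simp [mul_assoc]))
      · have h1 : a.out⁻¹ * g * (g' • c).out ∉ H := by rwa [out_inv_mul_mul_out_mem_iff]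
        have h3 : a.out⁻¹ * (g * g') * c.out ∉ H := by rwa [out_inv_mul_mul_out_mem_iff, mul_smul]
        simp [Subgroup.extendZero_of_notMem _ h1, Subgroup.extendZero_of_notMem _ h3]
    · intro b _ hb
      have h2 : b.out⁻¹ * g' * c.out ∉ H := by
        rw [out_inv_mul_mul_out_mem_iff]; exact fun h => hb h.symm
      simp [M, Subgroup.extendZero_of_notMem _ h2]
    · simp
  refine .of_matrix ⟨⟨M, h1⟩, hmul⟩ fun g => ?_
  simp only [_root_.inducedFunction, finsum_eq_sum_of_fintype, MonoidHom.coe_mk, OneHom.coe_mk,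
    Matrix.trace, Matrix.diag, M, Matrix.of_apply, Fintype.sum_prod_type, map_sum]
  refine Finset.sum_congr rfl fun a _ => ?_
  by_cases ha : a.out⁻¹ * g * a.out ∈ H
  · simp only [Subgroup.extendZero_of_mem _ ha, hρ, Matrix.trace, map_sum, Matrix.diag]
  · simp [Subgroup.extendZero_of_notMem _ ha]

/-- Inducing the restriction of a class function multiplies it by the permutation character of
`G ⧸ H`. -/
theorem inducedFunction_restrict (H : Subgroup G) {χ : G → ℂ} (hχ : IsCharacter K χ) (g : G) :
    inducedFunction H (χ ∘ H.subtype) g = χ g * Nat.card {a : G ⧸ H // g • a = a} := by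
  classical
  have := Fintype.ofFinite (G ⧸ H)
  have h : ∀ a : G ⧸ H, H.extendZero (χ ∘ H.subtype) (a.out⁻¹ * g * a.out) =
      if g • a = a then χ g else 0 := by
    intro a
    split_ifs with ha
    · rw [Subgroup.extendZero_of_mem _ ((out_inv_mul_mul_out_mem_iff _ _ _ _).2 ha)]
      exact hχ.conj_apply g _
    · rw [Subgroup.extendZero_of_notMem]
      rwa [out_inv_mul_mul_out_mem_iff]
  rw [inducedFunction, finsum_eq_sum_of_fintype, Finset.sum_congr rfl fun a _ => h a,
    ← Finset.sum_filter, Finset.sum_const, nsmul_eq_mul, mul_comm, Nat.card_eq_fintype_card,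
    Fintype.card_subtype]

/-- If `V` is the direct sum of the translates of an `H`-stable subspace `W` along the cosets of
`H`, its character is induced from the character of `W`. -/
theorem char_eq_inducedFunction {V : Type*} [AddCommGroup V] [Module ℂ V] [FiniteDimensional ℂ V]
    (ρ : Representation ℂ G V) (H : Subgroup G)
    (W : Subrepresentation (ρ.comp H.subtype)) [DecidableEq (G ⧸ H)]
    (hW : DirectSum.IsInternal fun a : G ⧸ H => W.toSubmodule.map (ρ a.out)) (g : G) :
    ρ.character g = inducedFunction H W.toRepresentation.character g := by
  have := Fintype.ofFinite (G ⧸ H)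
  let b := finBasis ℂ W.toSubmodule
  have hinj : ∀ s : G, Function.Injective (ρ s) := fun s => (ρ.apply_bijective s).1
  let c : ∀ a : G ⧸ H, Basis _ ℂ (W.toSubmodule.map (ρ a.out)) := fun a =>
    b.map (Submodule.equivMapOfInjective _ (hinj a.out) W.toSubmodule)
  have hc : ∀ a i, (c a i : V) = ρ a.out (b i) := fun a i => by simp [c]
  let B := hW.collectedBasis c
  rw [Representation.character, LinearMap.trace_eq_matrix_trace ℂ B, Matrix.trace,
    Fintype.sum_sigma, inducedFunction, finsum_eq_sum_of_fintype]
  refine Finset.sum_congr rfl fun a _ => ?_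
  simp only [Matrix.diag, LinearMap.toMatrix_apply]
  have hg : ∀ i, ρ g (B ⟨a, i⟩) = ρ (g * a.out) (b i) := fun i => by
    simp only [B, DirectSum.IsInternal.collectedBasis_coe, hc, map_mul]; rfl
  by_cases ha : g • a = a
  · have hm := (out_inv_mul_mul_out_mem_iff H g a a).2 ha
    rw [Subgroup.extendZero_of_mem _ hm, Representation.character,
      LinearMap.trace_eq_matrix_trace ℂ b, Matrix.trace]
    refine Finset.sum_congr rfl fun i _ => ?_
    let w : W.toSubmodule := W.toRepresentation ⟨_, hm⟩ (b i)
    have hw : ρ g (B ⟨a, i⟩) = ρ a.out w := by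
      rw [hg]
      change _ = ρ a.out (ρ (a.out⁻¹ * g * a.out) (b i))
      rw [← Module.End.mul_apply, ← map_mul]
      congr 2
      group
    have hmem : ρ g (B ⟨a, i⟩) ∈ W.toSubmodule.map (ρ a.out) := hw ▸ Submodule.mem_map_of_mem w.2
    rw [DirectSum.IsInternal.collectedBasis_repr_of_mem hW c hmem, Matrix.diag,
      LinearMap.toMatrix_apply]
    have : (⟨ρ g (B ⟨a, i⟩), hmem⟩ : W.toSubmodule.map (ρ a.out)) =
        Submodule.equivMapOfInjective _ (hinj a.out) W.toSubmodule w := Subtype.ext hw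
    rw [this]
    simp [c, w]
  · rw [Subgroup.extendZero_of_notMem _ (mt (out_inv_mul_mul_out_mem_iff H g a a).1 ha)]
    refine Finset.sum_eq_zero fun i _ => ?_
    have hm := (out_inv_mul_mul_out_mem_iff H g (g • a) a).2 rfl
    refine DirectSum.IsInternal.collectedBasis_repr_of_mem_ne hW c (i := g • a) ha ?_
    refine ⟨ρ ((g • a).out⁻¹ * g * a.out) (b i), W.apply_mem_toSubmodule ⟨_, hm⟩ (b i).2, ?_⟩
    rw [hg, ← Module.End.mul_apply, ← map_mul]
    congr 2
    group

end Induction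

/-! ### Hyperelementary groups -/

section Hyperelementary

/-- A group is `p`-hyperelementary (also called `p`-quasi-elementary) if it has a normal cyclic
subgroup, given here by a generator `c`, such that the quotient by it is a `p`-group. -/
def IsHyperelementary (p : ℕ) (G : Type*) [Group G] : Prop :=
  ∃ c : G, (Subgroup.zpowers c).Normal ∧ ∀ g : G, ∃ k : ℕ, g ^ p ^ k ∈ Subgroup.zpowers c

variable {p : ℕ} {G : Type*} [Group G]

theorem IsHyperelementary.of_injective {H : Type*} [Group H] (hG : IsHyperelementary p G)
    (f : H →* G) (hf : Function.Injective f) : IsHyperelementary p H := by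
  obtain ⟨c, hc, hk⟩ := hG
  let C := (Subgroup.zpowers c).comap f
  have : IsCyclic C :=
    isCyclic_of_injective (f.subgroupComap (Subgroup.zpowers c)) fun a b h =>
      Subtype.ext (hf (congrArg Subtype.val h))
  obtain ⟨d, hd⟩ := (Subgroup.isCyclic_iff_exists_zpowers_eq_top C).1 this
  refine ⟨d, hd ▸ hc.comap f, fun h => ?_⟩
  obtain ⟨k, hk⟩ := hk (f h)
  refine ⟨k, hd ▸ ?_⟩
  rwa [Subgroup.mem_comap, map_pow]

theorem IsHyperelementary.of_surjective {H : Type*} [Group H] (hG : IsHyperelementary p G)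
    (f : G →* H) (hf : Function.Surjective f) : IsHyperelementary p H := by
  obtain ⟨c, hc, hk⟩ := hG
  refine ⟨f c, f.map_zpowers c ▸ hc.map f hf, fun h => ?_⟩
  obtain ⟨g, rfl⟩ := hf h
  obtain ⟨k, hk⟩ := hk g
  exact ⟨k, f.map_zpowers c ▸ ⟨_, hk, map_pow f _ _⟩⟩

/-- A nontrivial hyperelementary group has a nontrivial cyclic normal subgroup: the given one or,
if this is trivial, any nontrivial subgroup of the center of the `p`-group. -/
theorem IsHyperelementary.exists_ne_one [Finite G] [Nontrivial G] (hp : p.Prime)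
    (hG : IsHyperelementary p G) :
    ∃ y : G, y ≠ 1 ∧ ∀ h : G, h⁻¹ * y * h ∈ Subgroup.zpowers y := by
  obtain ⟨c, hc, hk⟩ := hG
  by_cases h1 : c = 1
  · have := Fact.mk hp
    have hG : IsPGroup p G := isPGroup_iff_pow_pow_eq_one.2 fun g => by simpa [h1] using hk g
    have := hG.center_nontrivial
    obtain ⟨y, hy⟩ := exists_ne (1 : Subgroup.center G)
    refine ⟨y, fun h => hy (Subtype.ext h), fun h => ?_⟩
    rw [mul_assoc, ← Subgroup.mem_center_iff.1 y.2 h, inv_mul_cancel_left]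
    exact Subgroup.mem_zpowers _
  · exact ⟨c, h1, fun h => by
      simpa using hc.conj_mem c (Subgroup.mem_zpowers c) h⁻¹⟩

/-- A nontrivial cyclic normal subgroup of the quotient `G ⧸ Z`, expressed in `G`. -/
theorem IsHyperelementary.exists_notMem [Finite G] (hp : p.Prime) (hG : IsHyperelementary p G)
    (Z : Subgroup G) [Z.Normal] (hZ : Z ≠ ⊤) :
    ∃ x ∉ Z, ∀ h : G, ∃ k : ℕ, ∃ z ∈ Z, h⁻¹ * x * h = x ^ k * z := by
  have : Nontrivial (G ⧸ Z) := by rwa [QuotientGroup.nontrivial_iff]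
  obtain ⟨y, hy, hyz⟩ :=
    (hG.of_surjective (QuotientGroup.mk' Z) (QuotientGroup.mk'_surjective Z)).exists_ne_one hp
  obtain ⟨x, rfl⟩ := QuotientGroup.mk'_surjective Z y
  refine ⟨x, fun h => hy ((QuotientGroup.eq_one_iff x).2 h), fun h => ?_⟩
  obtain ⟨k, hk⟩ := mem_powers_iff_mem_zpowers.2 (hyz (QuotientGroup.mk' Z h))
  refine ⟨k, (x ^ k)⁻¹ * (h⁻¹ * x * h), ?_, by group⟩
  rw [← QuotientGroup.eq]
  simpa using hk

end Hyperelementary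

/-! ### Characters of hyperelementary groups -/

section Monomial

variable {K : Type*} [Field K] [Algebra K ℂ]

theorem isCharacter_of_scalar {G V : Type*} [Group G] [Finite G] [AddCommGroup V] [Module ℂ V]
    [FiniteDimensional ℂ V] (hK : ∀ z : ℂ, z ^ Nat.card G = 1 → ∃ a : K, algebraMap K ℂ a = z)
    (ρ : Representation ℂ G V) (hρ : ∀ g, ∃ c : ℂ, ρ g = c • 1) : IsCharacter K ρ.character := by
  rcases subsingleton_or_nontrivial V with hV | hV
  · refine ⟨0, 1, fun g => ?_⟩
    rw [Representation.character, Subsingleton.elim (ρ g) 0]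
    simp [Matrix.trace]
  choose c hc using hρ
  have hinj : Function.Injective fun z : ℂ => z • (1 : End ℂ V) := smul_left_injective ℂ one_ne_zero
  have hc1 : c 1 = 1 := hinj (by simp [← hc])
  have hcm : ∀ g h, c (g * h) = c g * c h := fun g h => hinj (by
    change c (g * h) • (1 : End ℂ V) = (c g * c h) • (1 : End ℂ V)
    rw [← hc, map_mul, hc, hc, smul_mul_smul, mul_one])
  let c' : G →* ℂ := ⟨⟨c, hc1⟩, hcm⟩
  choose d hd using fun g => hK (c g) (by
    have := map_pow c' g (Nat.card G)
    rw [pow_card_eq_one', map_one] at this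
    exact this.symm)
  have hKinj := (algebraMap K ℂ).injective
  let d' : G →* K :=
    ⟨⟨d, hKinj (by rw [hd, hc1, map_one])⟩, fun g h => hKinj (by simp [hd, hcm])⟩
  refine ⟨finrank ℂ V, (Matrix.scalar (Fin (finrank ℂ V))).toMonoidHom.comp d', fun g => ?_⟩
  rw [Representation.character, hc, map_smul, LinearMap.trace_one]
  simp [Matrix.trace, d', hd, mul_comm]

/-- The normal subgroup of the elements acting by a nonzero scalar. -/
def scalarSubgroup {G V : Type*} [Group G] [AddCommGroup V] [Module ℂ V]
    (ρ : Representation ℂ G V) : Subgroup G where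
  carrier := {g | ∃ c : ℂ, c ≠ 0 ∧ ρ g = c • 1}
  one_mem' := ⟨1, one_ne_zero, by simp⟩
  mul_mem' := by
    rintro a b ⟨c, hc0, hc⟩ ⟨d, hd0, hd⟩
    exact ⟨c * d, mul_ne_zero hc0 hd0, by rw [map_mul, hc, hd, smul_mul_smul, mul_one]⟩
  inv_mem' := by
    rintro a ⟨c, hc0, hc⟩
    refine ⟨c⁻¹, inv_ne_zero hc0, ?_⟩
    have h : ρ a⁻¹ * ρ a = 1 := by rw [← map_mul, inv_mul_cancel, map_one]
    rw [hc, mul_smul_comm, mul_one] at h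
    rw [← h, smul_smul, inv_mul_cancel₀ hc0, one_smul]

instance {G V : Type*} [Group G] [AddCommGroup V] [Module ℂ V] (ρ : Representation ℂ G V) :
    (scalarSubgroup ρ).Normal := by
  refine ⟨?_⟩
  rintro a ⟨c, hc0, hc⟩ g
  refine ⟨c, hc0, ?_⟩
  rw [map_mul, map_mul, hc, mul_smul_comm, mul_one, smul_mul_assoc, ← map_mul, mul_inv_cancel,
    map_one]

/-- The stabilizer of a subspace under a representation: the elements mapping `W` onto itself. -/
def subspaceStabilizer {G V : Type*} [Group G] [AddCommGroup V] [Module ℂ V]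
    (ρ : Representation ℂ G V) (W : Submodule ℂ V) : Subgroup G where
  carrier := {g | W.map (ρ g) = W}
  one_mem' := by
    change W.map (ρ 1) = W
    rw [map_one]; exact Submodule.map_id W
  mul_mem' := by
    intro a b (ha : W.map (ρ a) = W) (hb : W.map (ρ b) = W)
    change W.map (ρ (a * b)) = W
    rw [map_mul, Module.End.mul_eq_comp, Submodule.map_comp, hb, ha]
  inv_mem' := by
    intro a (ha : W.map (ρ a) = W)
    change W.map (ρ a⁻¹) = W
    conv_lhs => rw [← ha]
    rw [← Submodule.map_comp, ← Module.End.mul_eq_comp, ← map_mul, inv_mul_cancel, map_one]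
    exact Submodule.map_id W

/-- If `x` generates a normal subgroup modulo scalars, the group permutes the eigenspaces of `x`:
an eigenvector for `μ` is mapped by `h` to one for `μ ^ k * c`, if `h⁻¹ * x * h` acts as `x ^ k`
times the scalar `c`. -/
theorem exists_map_eigenspace_eq {G V : Type*} [Group G] [AddCommGroup V] [Module ℂ V]
    [FiniteDimensional ℂ V]
    (ρ : Representation ℂ G V) (x : G)
    (hx : ∀ h : G, ∃ k : ℕ, ∃ z ∈ scalarSubgroup ρ, h⁻¹ * x * h = x ^ k * z) (μ : ℂ)
    (hμ : Module.End.HasEigenvalue (ρ x) μ) (h : G) :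
    ∃ ν : ℂ, (Module.End.eigenspace (ρ x) μ).map (ρ h) = Module.End.eigenspace (ρ x) ν := by
  -- Every element maps an eigenspace of `ρ x` into another one; this is used for `h` and `h⁻¹`.
  have key : ∀ (μ : ℂ) (h : G), ∃ ν : ℂ,
      (Module.End.eigenspace (ρ x) μ).map (ρ h) ≤ Module.End.eigenspace (ρ x) ν := by
    intro μ h
    obtain ⟨k, z, ⟨c, -, hc⟩, hz⟩ := hx h
    refine ⟨μ ^ k * c, ?_⟩
    rintro _ ⟨v, hv, rfl⟩
    have hv' : ρ x v = μ • v := Module.End.mem_eigenspace_iff.1 hv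
    have hpow : ((ρ x) ^ k) v = μ ^ k • v := by
      clear hz
      induction k with
      | zero => simp
      | succ k ih => rw [pow_succ, Module.End.mul_apply, hv', map_smul, ih, smul_smul, pow_succ']
    rw [Module.End.mem_eigenspace_iff]
    have h1 : x * h = h * (x ^ k * z) := by rw [← hz]; group
    rw [← Module.End.mul_apply, ← map_mul, h1, map_mul, map_mul, hc, map_pow,
      Module.End.mul_apply, Module.End.mul_apply, LinearMap.smul_apply, Module.End.one_apply,
      map_smul, hpow, smul_smul, map_smul, mul_comm]
  obtain ⟨ν, hν⟩ := key μ h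
  obtain ⟨μ', hμ'⟩ := key ν h⁻¹
  have hid : ∀ v, ρ h⁻¹ (ρ h v) = v := fun v => by
    rw [← Module.End.mul_apply, ← map_mul, inv_mul_cancel, map_one, Module.End.one_apply]
  have hid' : ∀ v, ρ h (ρ h⁻¹ v) = v := fun v => by
    rw [← Module.End.mul_apply, ← map_mul, mul_inv_cancel, map_one, Module.End.one_apply]
  have heq : μ' = μ := by
    obtain ⟨v, hv⟩ := hμ.exists_hasEigenvector
    have h1 : ρ h⁻¹ (ρ h v) ∈ Module.End.eigenspace (ρ x) μ' :=
      hμ' (Submodule.mem_map_of_mem (hν (Submodule.mem_map_of_mem hv.1)))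
    rw [hid, Module.End.mem_eigenspace_iff, hv.apply_eq_smul] at h1
    exact (smul_left_injective ℂ hv.2 h1).symm
  refine ⟨ν, le_antisymm hν fun v hv => ⟨ρ h⁻¹ v, ?_, hid' v⟩⟩
  rw [← heq]
  exact hμ' (Submodule.mem_map_of_mem hv)

/-- The character of a complex representation of a hyperelementary group is the character of a
representation over `K`, if `K` contains enough roots of unity. In the irreducible case, either
all elements act by scalars, or there is an element `x`, not acting by a scalar, that generates a
normal subgroup modulo those acting by scalars; the group then permutes the eigenspaces of `x`,
and the representation is induced from the stabilizer of any of them. -/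
theorem IsHyperelementary.isCharacter {p : ℕ} (hp : p.Prime) {G : Type*} [Group G] [Finite G]
    (hG : IsHyperelementary p G)
    (hK : ∀ z : ℂ, z ^ Nat.card G = 1 → ∃ a : K, algebraMap K ℂ a = z)
    {V : Type*} [AddCommGroup V] [Module ℂ V] [FiniteDimensional ℂ V]
    (ρ : Representation ℂ G V) : IsCharacter K ρ.character := by
  classical
  induction hn : finrank ℂ V using Nat.strong_induction_on generalizing G V with
  | _ n ih =>
  by_cases hirr : ∃ A : Subrepresentation ρ, A ≠ ⊥ ∧ A ≠ ⊤
  · obtain ⟨A, hA, hA'⟩ := hirr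
    obtain ⟨B, hB⟩ := Representation.exists_isCompl_subrepresentation A
    have hBtop : B ≠ ⊤ := fun h => hA (by simpa [h] using hB.inf_eq_bot)
    have hlt : ∀ A : Subrepresentation ρ, A ≠ ⊤ → finrank ℂ A.toSubmodule < n := fun A hA =>
      hn ▸ Submodule.finrank_lt fun h => hA (Subrepresentation.toSubmodule_injective h)
    have := (ih _ (hlt A hA') hG hK A.toRepresentation rfl).add
      (ih _ (hlt B hBtop) hG hK B.toRepresentation rfl)
    convert this using 1
    ext g
    exact char_eq_add_of_isCompl hB g
  push Not at hirr
  by_cases hZ : scalarSubgroup ρ = ⊤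
  · refine isCharacter_of_scalar hK ρ fun g => ?_
    have : g ∈ scalarSubgroup ρ := hZ ▸ Subgroup.mem_top g
    exact ⟨this.choose, this.choose_spec.2⟩
  obtain ⟨x, hxZ, hx⟩ := hG.exists_notMem hp (scalarSubgroup ρ) hZ
  have hV : Nontrivial V := by
    by_contra hV
    rw [not_nontrivial_iff_subsingleton] at hV
    exact hxZ ⟨1, one_ne_zero, Subsingleton.elim _ _⟩
  obtain ⟨μ, hμ⟩ := Module.End.exists_eigenvalue (ρ x)
  choose ν hν using exists_map_eigenspace_eq ρ x hx μ hμ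
  let E := Module.End.eigenspace (ρ x) μ
  let T := subspaceStabilizer ρ E
  let W : Subrepresentation (ρ.comp T.subtype) :=
    ⟨E, fun g v hv => (show E.map (ρ g) = E from g.2) ▸ Submodule.mem_map_of_mem hv⟩
  have hWlt : finrank ℂ W.toSubmodule < n := by
    refine hn ▸ Submodule.finrank_lt fun h : E = ⊤ => hxZ ⟨μ, ?_, ?_⟩
    · rintro rfl
      obtain ⟨v, hv⟩ := hμ.exists_hasEigenvector
      have h1 := hv.apply_eq_smul
      rw [zero_smul] at h1
      exact hv.2 ((ρ.apply_bijective x).1 (h1.trans (map_zero _).symm))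
    · ext v
      exact Module.End.mem_eigenspace_iff.1 (h ▸ Submodule.mem_top : v ∈ E)
  have hmapE : ∀ g h : G, (E.map (ρ h)).map (ρ g) = E.map (ρ (g * h)) := fun g h => by
    rw [← Submodule.map_comp, map_mul, Module.End.mul_eq_comp]
  have hT : ∀ g h : G, E.map (ρ g) = E.map (ρ h) → g⁻¹ * h ∈ T := by
    intro g h hgh
    change E.map (ρ (g⁻¹ * h)) = E
    rw [← hmapE, ← hgh, hmapE, inv_mul_cancel]
    exact T.one_mem
  have hT' : ∀ g h : G, g⁻¹ * h ∈ T → E.map (ρ g) = E.map (ρ h) := by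
    intro g h hgh
    have : E.map (ρ (g⁻¹ * h)) = E := hgh
    conv_lhs => rw [← this, hmapE, mul_inv_cancel_left]
  have hint : DirectSum.IsInternal fun a : G ⧸ T => W.toSubmodule.map (ρ a.out) := by
    rw [DirectSum.isInternal_submodule_iff_iSupIndep_and_iSup_eq_top]
    constructor
    · have hinj : Function.Injective fun a : G ⧸ T => ν a.out := by
        intro a b hab
        have : E.map (ρ a.out) = E.map (ρ b.out) := by
          rw [hν, hν]; exact congrArg _ hab
        rw [← QuotientGroup.out_eq' a, ← QuotientGroup.out_eq' b]
        exact QuotientGroup.eq.2 (hT _ _ this)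
      have := (Module.End.eigenspaces_iSupIndep (ρ x)).comp hinj
      convert this using 2 with a
      exact hν a.out
    · -- The translates of the eigenspace span a subrepresentation, which is everything.
      let S : Subrepresentation ρ := ⟨⨆ a : G ⧸ T, E.map (ρ a.out), fun g v hv => by
        have : (⨆ a : G ⧸ T, E.map (ρ a.out)).map (ρ g) ≤ ⨆ a : G ⧸ T, E.map (ρ a.out) := by
          rw [Submodule.map_iSup]
          refine iSup_le fun a => ?_
          rw [hmapE, hT' (g * a.out) (g • a).out]
          · exact le_iSup (fun a : G ⧸ T => E.map (ρ a.out)) (g • a)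
          · have := (out_inv_mul_mul_out_mem_iff T g (g • a) a).2 rfl
            simpa [mul_assoc] using T.inv_mem this
        exact this (Submodule.mem_map_of_mem hv)⟩
      have hS : S ≠ ⊥ := by
        intro h
        have h1 : E.map (ρ (Quotient.out ((1 : G) : G ⧸ T))) ≤ (⊥ : Submodule ℂ V) := by
          have h2 : S.toSubmodule = ⊥ := by rw [h]; rfl
          rw [← h2]
          exact le_iSup (fun a : G ⧸ T => E.map (ρ a.out)) _
        obtain ⟨v, hv⟩ := hμ.exists_hasEigenvector
        have h3 := h1 (Submodule.mem_map_of_mem hv.1)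
        exact hv.2 ((ρ.apply_bijective _).1 (((Submodule.mem_bot _).1 h3).trans (map_zero _).symm))
      exact congrArg Subrepresentation.toSubmodule (hirr S hS)
  have hcard : Nat.card T ∣ Nat.card G := Subgroup.card_subgroup_dvd_card T
  have := ih _ hWlt (hG.of_injective T.subtype T.subtype_injective)
    (fun z hz => hK z (by obtain ⟨k, hk⟩ := hcard; rw [hk, pow_mul, hz, one_pow]))
    W.toRepresentation rfl
  convert this.inducedFunction using 1
  ext g
  exact char_eq_inducedFunction ρ T W hint g

end Monomial

/-! ### Solomon's induction theorem -/

section Solomon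

variable {G : Type*} [Group G] [Finite G]

/-- For every `g` and every prime `p` there is a `p`-hyperelementary subgroup `H` such that the
number of fixed points of `g` on `G ⧸ H` is prime to `p`. If `C` is the part of order prime to `p`
of the cyclic group generated by `g`, one takes for `H` the preimage of a Sylow `p`-subgroup of
`N ⧸ C`, where `N` is the normalizer of `C`. The fixed points of `C` are then the cosets in `N`;
their number is prime to `p`, and `g` acts on them as a permutation of `p`-power order. -/
theorem exists_isHyperelementary_not_dvd {p : ℕ} (hp : p.Prime) (g : G) :
    ∃ H : Subgroup G, IsHyperelementary p H ∧ ¬ p ∣ Nat.card {a : G ⧸ H // g • a = a} := by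
  classical
  have := Fact.mk hp
  obtain ⟨k, m, hm, hkm⟩ := Nat.exists_eq_pow_mul_and_not_dvd (orderOf_pos g).ne' p hp.ne_one
  -- `c` generates the subgroup `C` of order `m`, the `p`-free part of the order of `g`.
  let c := g ^ p ^ k
  have hc : orderOf c = m := by
    rw [orderOf_pow_of_dvd (pow_ne_zero _ hp.ne_zero) (hkm ▸ dvd_mul_right _ _), hkm,
      Nat.mul_div_cancel_left _ (pow_pos hp.pos _)]
  have hcop : ∀ j, Nat.Coprime (orderOf c) (p ^ j) := fun j =>
    hc ▸ (Nat.Coprime.pow_left j ((Nat.Prime.coprime_iff_not_dvd hp).2 hm)).symm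
  let C := Subgroup.zpowers c
  let N := Subgroup.normalizer (C : Set G)
  have hCN : C ≤ N := Subgroup.le_normalizer
  let C' : Subgroup N := C.subgroupOf N
  have hC' : C'.Normal := Subgroup.normal_in_normalizer
  let P : Sylow p (N ⧸ C') := default
  let H' : Subgroup N := (P : Subgroup (N ⧸ C')).comap (QuotientGroup.mk' C')
  let H : Subgroup G := H'.map N.subtype
  have hCH : C ≤ H := fun y hy => ⟨⟨y, hCN hy⟩, by
    change (QuotientGroup.mk' C') _ ∈ (P : Subgroup (N ⧸ C'))
    have : QuotientGroup.mk' C' ⟨y, hCN hy⟩ = 1 := (QuotientGroup.eq_one_iff _).2 hy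
    exact this ▸ one_mem _, rfl⟩
  have hHN : H ≤ N := Subgroup.map_subtype_le _
  have hcH : c ∈ H := hCH (Subgroup.mem_zpowers c)
  have hconj : ∀ x ∈ N, ∀ y ∈ C, x⁻¹ * y * x ∈ C := fun x hx y hy =>
    (Subgroup.mem_normalizer_iff''.1 hx y).1 hy
  -- Modulo `C` every element of `H` has `p`-power order.
  have hpow : ∀ h ∈ H, ∃ j : ℕ, h ^ p ^ j ∈ C := by
    rintro _ ⟨h, hh, rfl⟩
    obtain ⟨j, hj⟩ := isPGroup_iff_pow_pow_eq_one.1 P.isPGroup' ⟨_, hh⟩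
    exact ⟨j, (QuotientGroup.eq_one_iff (N := C') (h ^ p ^ j)).1 (congrArg Subtype.val hj)⟩
  have hyper : IsHyperelementary p H := by
    have hz : ∀ h : H, h ∈ Subgroup.zpowers (⟨c, hcH⟩ : H) ↔ (h : G) ∈ C := fun h =>
      ⟨fun ⟨i, hi⟩ => ⟨i, congrArg Subtype.val hi⟩, fun ⟨i, hi⟩ => ⟨i, Subtype.ext hi⟩⟩
    refine ⟨⟨c, hcH⟩, ⟨fun y hy h => ?_⟩, fun h => ?_⟩
    · rw [hz] at hy ⊢
      simpa using hconj _ (inv_mem (hHN h.2)) _ hy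
    · obtain ⟨j, hj⟩ := hpow h h.2
      exact ⟨j, (hz _).2 hj⟩
  -- The cosets fixed by `c` are those in `N`.
  have hfix : ∀ x : G, c • (x : G ⧸ H) = x ↔ x ∈ N := by
    intro x
    have h1 : c • (x : G ⧸ H) = x ↔ x⁻¹ * c * x ∈ H := by
      rw [eq_comm, mul_assoc, ← QuotientGroup.eq]; rfl
    rw [h1]
    refine ⟨fun hx => ?_, fun hx => hCH (hconj x hx c (Subgroup.mem_zpowers c))⟩
    obtain ⟨j, hj⟩ := hpow _ hx
    -- `x⁻¹ * c * x` has order prime to `p`, so it is a power of its `p ^ j`-th power.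
    have hord : orderOf (x⁻¹ * c * x) = orderOf c := by
      simpa using (MulAut.conj x⁻¹).orderOf_eq c
    have hmem : x⁻¹ * c * x ∈ Subgroup.zpowers ((x⁻¹ * c * x) ^ p ^ j) := by
      rw [mem_zpowers_pow_iff, hord]
      exact (hcop j).symm
    have hxc : x⁻¹ * c * x ∈ C := (Subgroup.zpowers_le.2 hj) hmem
    rw [← inv_mem_iff]
    refine Subgroup.mem_normalizer_fintype fun y hy => ?_
    obtain ⟨i, rfl⟩ := hy
    have : x⁻¹ * c ^ i * x⁻¹⁻¹ = (x⁻¹ * c * x) ^ i := by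
      rw [← conj_zpow (a := x⁻¹)]; simp
    change x⁻¹ * c ^ i * x⁻¹⁻¹ ∈ C
    exact this ▸ zpow_mem hxc i
  have hidx : ¬ p ∣ H.relIndex N := by
    have : H.relIndex N = (P : Subgroup (N ⧸ C')).index := by
      rw [Subgroup.relIndex, show H.subgroupOf N = H' from
        Subgroup.comap_map_eq_self_of_injective N.subtype_injective H',
        Subgroup.index_comap_of_surjective _ (QuotientGroup.mk'_surjective C')]
    rw [this]
    exact P.not_dvd_index
  have hcard : Nat.card {a : G ⧸ H // c • a = a} = H.relIndex N := by
    have hstab : MulAction.stabilizer N ((1 : G) : G ⧸ H) = H.subgroupOf N := by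
      ext x
      rw [MulAction.mem_stabilizer_iff, Subgroup.mem_subgroupOf, eq_comm]
      change ((1 : G) : G ⧸ H) = ((x * 1 : G) : G ⧸ H) ↔ _
      rw [QuotientGroup.eq]
      simp
    -- The cosets in `N` form the orbit of the trivial coset under `N`.
    rw [Subgroup.relIndex, ← hstab, MulAction.index_stabilizer]
    change Set.ncard {a : G ⧸ H | c • a = a} = _
    congr 1
    ext a
    obtain ⟨x, rfl⟩ := QuotientGroup.mk_surjective a
    rw [Set.mem_ofPred_eq, hfix]
    constructor
    · exact fun hx => ⟨⟨x, hx⟩, congrArg (QuotientGroup.mk (s := H)) (mul_one x)⟩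
    · rintro ⟨y, hy⟩
      have hy' : ((y * 1 : G) : G ⧸ H) = x := hy
      rw [mul_one, QuotientGroup.eq] at hy'
      simpa using mul_mem y.2 (hHN hy')
  -- On the fixed points of `c = g ^ p ^ k`, the permutation by `g` has `p`-power order.
  have hmod : Nat.card {a : G ⧸ H // c • a = a} ≡ Nat.card {a : G ⧸ H // g • a = a} [MOD p] := by
    have := Fintype.ofFinite {a : G ⧸ H // c • a = a}
    have hcg : ∀ a : G ⧸ H, c • a = a → c • g • a = g • a := fun a ha => by
      rw [← mul_smul, ← (Commute.pow_self g (p ^ k) : Commute c g).eq.symm, mul_smul, ha]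
    let f : Function.End {a : G ⧸ H // c • a = a} := fun a => ⟨g • a.1, hcg _ a.2⟩
    have hf : ∀ (i : ℕ) a, ((f ^ i) a).1 = g ^ i • a.1 := by
      intro i
      induction i with
      | zero => intro a; rw [pow_zero, pow_zero, one_smul]; rfl
      | succ i ih =>
        intro a
        rw [pow_succ, pow_succ, mul_smul]
        exact ih (f a)
    have hf1 : f ^ p ^ k = 1 := funext fun a => Subtype.ext ((hf _ a).trans a.2)
    have h := Equiv.Perm.card_fixedPoints_modEq hf1
    rw [← Nat.card_eq_fintype_card, ← Nat.card_eq_fintype_card] at h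
    have h1 : ∀ a : G ⧸ H, g • a = a → c • a = a := fun a ha => by
      have : ∀ i : ℕ, g ^ i • a = a := fun i => by
        induction i with
        | zero => simp
        | succ i ih => rw [pow_succ, mul_smul, ha, ih]
      exact this _
    let e : f.fixedPoints ≃ {a : G ⧸ H // g • a = a} :=
      { toFun := fun a => ⟨a.1.1, congrArg Subtype.val a.2⟩
        invFun := fun a => ⟨⟨a.1, h1 _ a.2⟩, Subtype.ext a.2⟩
        left_inv := fun _ => rfl
        right_inv := fun _ => rfl }
    rwa [Nat.card_congr e] at h
  refine ⟨H, hyper, fun hdvd => hidx ?_⟩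
  rw [← hcard]
  exact (hmod.dvd_iff dvd_rfl).2 hdvd

/-- A nonunital ring of integer-valued functions on a finite set contains the constant function
`1` if there is no point and no prime `p` such that all its functions are divisible by `p` at this
point. -/
theorem one_mem_of_forall_exists_not_dvd {X : Type*} [Finite X] {J : AddSubgroup (X → ℤ)}
    (hmul : ∀ f ∈ J, ∀ f' ∈ J, f * f' ∈ J)
    (hJ : ∀ p : ℕ, p.Prime → ∀ g : X, ∃ f ∈ J, ¬ (p : ℤ) ∣ f g) : (1 : X → ℤ) ∈ J := by
  classical
  have := Fintype.ofFinite X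
  have h1 : ∀ g, ∃ f ∈ J, f g = 1 := by
    intro g
    obtain ⟨n, hn⟩ := Int.subgroup_cyclic (J.map (Pi.evalAddMonoidHom (fun _ : X => ℤ) g))
    have hdvd : ∀ f ∈ J, n ∣ f g := fun f hf => by
      have : f g ∈ J.map (Pi.evalAddMonoidHom (fun _ : X => ℤ) g) := ⟨f, hf, rfl⟩
      rw [hn, AddSubgroup.mem_closure_singleton] at this
      obtain ⟨k, hk⟩ := this
      exact ⟨k, by rw [← hk, smul_eq_mul, mul_comm]⟩
    -- The values at `g` form a subgroup of `ℤ` that is not contained in any `p ℤ`.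
    have hn1 : n.natAbs = 1 := by
      by_contra hne
      obtain ⟨p, hp, hpn⟩ := Nat.exists_prime_and_dvd hne
      obtain ⟨f, hf, hpf⟩ := hJ p hp g
      exact hpf ((Int.natCast_dvd.2 hpn).trans (hdvd f hf))
    have : (1 : ℤ) ∈ J.map (Pi.evalAddMonoidHom (fun _ : X => ℤ) g) := by
      rw [hn, AddSubgroup.mem_closure_singleton]
      rcases Int.natAbs_eq_iff.1 hn1 with rfl | rfl
      · exact ⟨1, by simp⟩
      · exact ⟨-1, by simp⟩
    exact this
  have h2 : ∀ s : Finset X, ∃ f ∈ J, ∀ g ∈ s, f g = 1 := by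
    intro s
    induction s using Finset.induction_on with
    | empty => exact ⟨0, J.zero_mem, by simp⟩
    | insert a s _ ih =>
      obtain ⟨f, hf, hfs⟩ := ih
      obtain ⟨f', hf', hfa⟩ := h1 a
      -- `1 - (f + f' - f * f') = (1 - f) * (1 - f')`.
      refine ⟨f + f' - f * f', J.sub_mem (J.add_mem hf hf') (hmul f hf f' hf'), fun g hg => ?_⟩
      rcases Finset.mem_insert.1 hg with rfl | hg
      · simp [hfa]
      · simp [hfs g hg]
  obtain ⟨f, hf, h⟩ := h2 Finset.univ
  convert hf
  ext g
  exact (h g (Finset.mem_univ g)).symm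

variable {K : Type*} [Field K] [Algebra K ℂ]

/-- The integer-valued functions on `G` that multiply every complex character of `G` into the
virtual characters over `K`. They form a nonunital ring, and the aim is to show that it
contains `1`. -/
def multiplierSubgroup (G : Type*) [Group G] (K : Type*) [Field K] [Algebra K ℂ] :
    AddSubgroup (G → ℤ) where
  carrier := {f | ∀ χ : G → ℂ, IsCharacter ℂ χ → (fun g => (f g : ℂ) * χ g) ∈ virtualCharacters G K}
  zero_mem' := fun χ _ => by
    convert (virtualCharacters G K).zero_mem using 1
    ext g
    simp
  add_mem' := fun {f f'} hf hf' χ hχ => by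
    convert (virtualCharacters G K).add_mem (hf χ hχ) (hf' χ hχ) using 1
    ext g
    simp [add_mul]
  neg_mem' := fun {f} hf χ hχ => by
    convert (virtualCharacters G K).neg_mem (hf χ hχ) using 1
    ext g
    simp

omit [Finite G] in
/-- The product `f' * χ` is a difference of characters over `K`, in particular of complex
characters, to which `f` can be applied again. -/
theorem mul_mem_multiplierSubgroup {f f' : G → ℤ} (hf : f ∈ multiplierSubgroup G K)
    (hf' : f' ∈ multiplierSubgroup G K) : f * f' ∈ multiplierSubgroup G K := by
  intro χ hχ
  obtain ⟨χ₁, χ₂, h₁, h₂, h⟩ := exists_eq_sub_of_mem_virtualCharacters (hf' χ hχ)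
  convert (virtualCharacters G K).sub_mem (hf χ₁ h₁.complex) (hf χ₂ h₂.complex) using 1
  ext g
  have := congrFun h g
  simp only [Pi.sub_apply] at this ⊢
  rw [← mul_sub, ← this]
  simp [mul_assoc]

/-- The product of `χ` with the permutation character of `G ⧸ H` is induced from the restriction
of `χ` to `H`, which is a character over `K`. -/
theorem IsHyperelementary.card_fixedPoints_mem {p : ℕ} (hp : p.Prime) {H : Subgroup G}
    (hH : IsHyperelementary p H)
    (hK : ∀ z : ℂ, z ^ Nat.card G = 1 → ∃ a : K, algebraMap K ℂ a = z) :
    (fun g => (Nat.card {a : G ⧸ H // g • a = a} : ℤ)) ∈ multiplierSubgroup G K := by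
  intro χ hχ
  have hcard : Nat.card H ∣ Nat.card G := Subgroup.card_subgroup_dvd_card H
  obtain ⟨n, ρ, hρ⟩ := (hχ.comp H.subtype).exists_representation
  have h := hH.isCharacter (K := K) hp
    (fun z hz => hK z (by obtain ⟨k, hk⟩ := hcard; rw [hk, pow_mul, hz, one_pow])) ρ
  have h' : χ ∘ H.subtype = ρ.character := funext hρ
  rw [← h'] at h
  convert h.inducedFunction.mem_virtualCharacters using 1
  ext g
  rw [inducedFunction_restrict H hχ, mul_comm]
  simp

/-- If `K` contains enough roots of unity, every complex character of `G` is the character of a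
representation over `K`. -/
theorem IsCharacter.of_complex [CharZero K]
    (hK : ∀ z : ℂ, z ^ Nat.card G = 1 → ∃ a : K, algebraMap K ℂ a = z)
    {χ : G → ℂ} (hχ : IsCharacter ℂ χ) : IsCharacter K χ := by
  have h1 : (1 : G → ℤ) ∈ multiplierSubgroup G K := by
    refine one_mem_of_forall_exists_not_dvd (fun f hf f' hf' => mul_mem_multiplierSubgroup hf hf')
      fun p hp g => ?_
    obtain ⟨H, hH, hdvd⟩ := exists_isHyperelementary_not_dvd hp g
    exact ⟨_, hH.card_fixedPoints_mem hp hK, by rwa [Int.natCast_dvd_natCast]⟩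
  obtain ⟨χ₁, χ₂, h₁, h₂, h⟩ := exists_eq_sub_of_mem_virtualCharacters (h1 χ hχ)
  refine hχ.of_eq_sub h₁ h₂ ?_
  rw [← h]
  simp

end Solomon

/-! ### Realizability over fields with enough roots of unity -/

section Realization

/-- A weak form of Brauer's theorem on splitting fields: a complex linear representation of `G`
is conjugate to one with entries in `K`, if `K` contains the roots of unity of order `|G|`. -/
theorem exists_conj_mem_range {G : Type*} [Group G] [Finite G] {K : Type*} [Field K] [CharZero K]
    [Algebra K ℂ] (hK : ∀ z : ℂ, z ^ Nat.card G = 1 → ∃ a : K, algebraMap K ℂ a = z) {n : ℕ}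
    (ρ : G →* Matrix.GeneralLinearGroup (Fin n) ℂ) :
    ∃ M : Matrix.GeneralLinearGroup (Fin n) ℂ, ∀ g i j, ∃ a : K,
      algebraMap K ℂ a = (M⁻¹ * ρ g * M : Matrix.GeneralLinearGroup (Fin n) ℂ).1 i j := by
  let ρ₁ : G →* Matrix (Fin n) (Fin n) ℂ := (Units.coeHom _).comp ρ
  have hχ : IsCharacter ℂ fun g => (ρ₁ g).trace := ⟨n, ρ₁, fun _ => rfl⟩
  obtain ⟨m, σ, hσ⟩ := hχ.of_complex hK
  obtain rfl : n = m := by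
    have := hσ 1
    simp only [map_one, Matrix.trace_one, Fintype.card_fin, map_natCast] at this
    exact_mod_cast this
  let σ₁ : G →* Matrix (Fin n) (Fin n) ℂ := (algebraMap K ℂ).mapMatrix.toMonoidHom.comp σ
  let rep (τ : G →* Matrix (Fin n) (Fin n) ℂ) : Representation ℂ G (Fin n → ℂ) :=
    (Matrix.toLinAlgEquiv' : _ ≃ₐ[ℂ] _).toMonoidHom.comp τ
  have hrep : ∀ τ g, (rep τ).character g = (τ g).trace := fun τ g => Matrix.trace_toLin'_eq (τ g)
  obtain ⟨e⟩ := nonempty_equiv_of_char_eq (rep σ₁) (rep ρ₁) (funext fun g => by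
    rw [hrep, hrep]
    refine Eq.trans ?_ (hσ g).symm
    exact (AddMonoidHom.map_trace (algebraMap K ℂ).toAddMonoidHom (σ g)).symm)
  let E := e.toLinearEquiv
  let M : Matrix.GeneralLinearGroup (Fin n) ℂ :=
    ⟨LinearMap.toMatrix' E.toLinearMap, LinearMap.toMatrix' E.symm.toLinearMap,
      by rw [← LinearMap.toMatrix'_comp]; simp, by rw [← LinearMap.toMatrix'_comp]; simp⟩
  refine ⟨M, fun g i j => ⟨σ g i j, ?_⟩⟩
  have h1 : E.toLinearMap ∘ₗ Matrix.toLin' (σ₁ g) = Matrix.toLin' (ρ₁ g) ∘ₗ E.toLinearMap :=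
    LinearMap.ext fun v => e.isIntertwining _ _ g v
  have h2 := congrArg LinearMap.toMatrix' h1
  rw [LinearMap.toMatrix'_comp, LinearMap.toMatrix'_comp, LinearMap.toMatrix'_toLin',
    LinearMap.toMatrix'_toLin'] at h2
  have h3 : (M⁻¹ * ρ g * M : Matrix.GeneralLinearGroup (Fin n) ℂ).1 = σ₁ g := by
    have h4 : M.1 * σ₁ g = (ρ g).1 * M.1 := h2
    rw [mul_assoc, Units.val_mul, Units.val_mul, ← h4, Units.inv_mul_cancel_left]
  rw [h3]
  rfl

end Realization

/-! ### The finite linear group attached to a projective representation -/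

section Projective

variable {G : Type*} [Group G] {n : ℕ}

theorem ProjectiveRepresentation.IsFactorSet.apply_one {Q : ProjectiveRepresentation ℂ G n}
    {α : G → G → ℂˣ} (hα : Q.IsFactorSet α) (hone : α 1 1 = 1) : Q.toFun 1 = 1 := by
  have h := hα 1 1
  rw [hone, Units.val_one, one_smul, mul_one, ← Units.val_mul] at h
  exact mul_eq_left.1 (Units.ext h)

/-- The linear group of all multiples `z • Q g` with `z` an `N`-th root of unity, where `N` is a
common exponent of the values of the factor set. It is a quotient of the central extension of `G`
by these roots of unity that is defined by the factor set. -/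
def ProjectiveRepresentation.linearGroup (Q : ProjectiveRepresentation ℂ G n) {α : G → G → ℂˣ}
    (hα : Q.IsFactorSet α) (hone : α 1 1 = 1) (N : ℕ) (hN : ∀ g h, α g h ^ N = 1) :
    Subgroup (Matrix.GeneralLinearGroup (Fin n) ℂ) where
  carrier := {A | ∃ (z : rootsOfUnity N ℂ) (g : G), A.1 = ((z : ℂˣ) : ℂ) • (Q.toFun g).1}
  one_mem' := ⟨1, 1, by simp [hα.apply_one hone]⟩
  mul_mem' := by
    rintro A B ⟨z, g, hA⟩ ⟨w, h, hB⟩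
    refine ⟨z * w * ⟨α g h, hN g h⟩, g * h, ?_⟩
    rw [Units.val_mul, hA, hB, smul_mul_smul, hα, smul_smul]
    rfl
  inv_mem' := by
    rintro A ⟨z, g, hA⟩
    refine ⟨z⁻¹ * (⟨α g g⁻¹, hN g g⁻¹⟩ : rootsOfUnity N ℂ)⁻¹, g⁻¹,
      Units.inv_eq_of_mul_eq_one_right ?_⟩
    rw [hA, smul_mul_smul, hα, smul_smul, mul_inv_cancel, hα.apply_one hone]
    simp

theorem ProjectiveRepresentation.finite_linearGroup [Finite G]
    (Q : ProjectiveRepresentation ℂ G n) {α : G → G → ℂˣ}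
    (hα : Q.IsFactorSet α) (hone : α 1 1 = 1) (N : ℕ) [NeZero N] (hN : ∀ g h, α g h ^ N = 1) :
    Finite (Q.linearGroup hα hone N hN) := by
  choose z g h using fun A : Q.linearGroup hα hone N hN => A.2
  refine Finite.of_injective (fun A => (z A, g A)) fun A B hAB => Subtype.ext (Units.ext ?_)
  rw [h A, h B, (Prod.mk.inj hAB).1, (Prod.mk.inj hAB).2]

end Projective

theorem theorem1p1 {G : Type*} [Group G] [Finite G] {n : ℕ}
    (Q : ProjectiveRepresentation ℂ G n) (α : G → G → ℂˣ) (hα : Q.IsFactorSet α)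
    (hroot : ∀ g h : G, ∃ m : ℕ, 0 < m ∧ α g h ^ m = 1)
    (hone : α 1 1 = 1) :
    ∃ Q' : ProjectiveRepresentation ℂ G n, Q.Similar Q' ∧
      ∃ (m : ℕ) (K : IntermediateField ℚ ℂ), 0 < m ∧ IsCyclotomicExtension {m} ℚ K ∧
        ∀ (g : G) (i j : Fin n), (Q'.toFun g : Matrix (Fin n) (Fin n) ℂ) i j ∈ K := by
  have := Fintype.ofFinite G
  choose m hm hmα using hroot
  -- A common exponent for all values of the factor set.
  let N := ∏ x : G × G, m x.1 x.2
  have hN0 : NeZero N := ⟨Finset.prod_ne_zero_iff.2 fun x _ => (hm x.1 x.2).ne'⟩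
  have hN : ∀ g h, α g h ^ N = 1 := fun g h => by
    obtain ⟨k, hk⟩ := Finset.dvd_prod_of_mem (fun x : G × G => m x.1 x.2) (Finset.mem_univ (g, h))
    change α g h ^ (∏ x : G × G, m x.1 x.2) = 1
    rw [hk, pow_mul, hmα, one_pow]
  let Γ := Q.linearGroup hα hone N hN
  have hΓ : Finite Γ := Q.finite_linearGroup hα hone N hN
  have hcard : Nat.card Γ ≠ 0 := Nat.card_pos.ne'
  let K : IntermediateField ℚ ℂ :=
    IntermediateField.adjoin ℚ {b | ∃ k ∈ ({Nat.card Γ} : Set ℕ), k ≠ 0 ∧ b ^ k = 1}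
  have hcyc : IsCyclotomicExtension {Nat.card Γ} ℚ K :=
    IntermediateField.isCyclotomicExtension_adjoin_of_exists_isPrimitiveRoot _ ℚ ℂ
      fun k _ hk => ⟨_, Complex.isPrimitiveRoot_exp k hk⟩
  obtain ⟨M, hM⟩ := exists_conj_mem_range (K := K) (fun z hz =>
    ⟨⟨z, IntermediateField.subset_adjoin _ _ ⟨_, rfl, hcard, hz⟩⟩, rfl⟩) Γ.subtype
  refine ⟨⟨fun g => M⁻¹ * Q.toFun g * M, fun g h => ⟨α g h, ?_⟩⟩, ⟨M, fun g => rfl⟩,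
    Nat.card Γ, K, Nat.pos_of_ne_zero hcard, hcyc, fun g i j => ?_⟩
  · have h1 : (M⁻¹ * Q.toFun g * M) * (M⁻¹ * Q.toFun h * M) =
        M⁻¹ * (Q.toFun g * Q.toFun h) * M := by group
    rw [← Units.val_mul, h1, Units.val_mul, Units.val_mul, Units.val_mul, hα, mul_smul_comm,
      smul_mul_assoc, Units.val_mul, Units.val_mul]
  · obtain ⟨a, ha⟩ := hM ⟨Q.toFun g, 1, g, by simp⟩ i j
    exact ha ▸ a.2
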